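/- Let $p \ge 0$ be an integer and let $V$ be a finite set with $|V|$ even. Let $\mathcal{G}(V,p)$ be the set of $p$-regular multigraphs on the labelled vertex set $V$, where loops and parallel edges are allowed and a loop contributes $2$ to the degree of its vertex. Thus an element of $\mathcal{G}(V,p)$ is determined by its multiset of edges. Two multigraphs $G, H \in \mathcal{G}(V,p)$ are related by a switching if there are two distinct (possibly parallel) edges $\{v,w\}, \{v',w'\}$ of $G$ such that $H$ is obtained from $G$ by replacing these two edges with the edges $\{v,v'\}, \{w,w'\}$. Let $d_{\mathrm{switch}}(G,H)$ be the minimum number of switchings needed to reach $H$ from $G$ ($\infty$ if this is impossible). Let $\mathcal{F} \subseteq \mathcal{G}(V,p)$ be the set of disjoint unions of Frobenius pairs, that is, of multigraphs obtained by partitioning $V$ into pairs and joining the two vertices of each pair by exactly $p$ parallel edges, with no other edges. Put $d_{\mathrm{switch}}(G,\mathcal{F}) = \min_{F \in \mathcal{F}} d_{\mathrm{switch}}(G,F)$. For an edge coloring $\sigma : E(G) \to C$ with a finite set $C$ of colors, let $\sigma(\partial v)$ be the multiset of colors of the edges incident to $v$, where the color of a loop at $v$ is counted twice. Call $\sigma$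 even if every multiset of colors equals $\sigma(\partial v)$ for an even number of vertices $v \in V$. Let $c_{\max}(G)$ be the maximum of $|\sigma(E(G))|$ over all even edge colorings $\sigma$ of $G$. Then for every $G \in \mathcal{G}(V,p)$ the distance $d_{\mathrm{switch}}(G,\mathcal{F})$ is finite and $$c_{\max}(G) = |E(G)| - d_{\mathrm{switch}}(G,\mathcal{F}).$$ -/

import Mathlib

/-- A finite multigraph on the labelled vertex set `V`, with loops and parallel edges allowed:
the multiset of its edges, each edge being an unordered pair of (possibly equal) vertices. -/
abbrev MultiGraph (V : Type*) := Multiset (Sym2 V)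

namespace MultiGraph

/-- The number of half-edges of the edge `e` at `v`: `0` or `1` if `e` is not a loop,
and `2` if `e` is a loop at `v`. -/
def inc {V : Type*} [DecidableEq V] (e : Sym2 V) (v : V) : ℕ := e.toMultiset.count v

/-- The degree of a vertex; a loop counts twice. -/
def degree {V : Type*} [DecidableEq V] (G : MultiGraph V) (v : V) : ℕ :=
  (G.map fun e => inc e v).sum

/-- The set `𝒢(V, p)` of labelled multigraphs on `V` with degree sequence `p`. -/
abbrev WithDegrees (V : Type*) [DecidableEq V] (p : V → ℕ) :=
  {G : MultiGraph V // ∀ v, G.degree v = p v}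

/-- `H` arises from `G` by replacing two distinct edges (distinct members of the edge multiset,
possibly parallel) `{v, w}`, `{v', w'}` by `{v, v'}`, `{w, w'}`. -/
def Switching {V : Type*} (G H : MultiGraph V) : Prop :=
  ∃ (v w v' w' : V) (R : MultiGraph V),
    G = s(v, w) ::ₘ s(v', w') ::ₘ R ∧ H = s(v, v') ::ₘ s(w, w') ::ₘ R

/-- `𝒢(V, p)` viewed as a graph whose adjacency is being (distinct and) related by a switching. -/
def switchGraph (V : Type*) [DecidableEq V] (p : V → ℕ) : SimpleGraph (WithDegrees V p) :=
  SimpleGraph.fromRel fun G H => Switching G.1 H.1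

/-- The switching distance on `𝒢(V, p)` (`⊤` if there is no path). -/
noncomputable def dSwitch {V : Type*} [DecidableEq V] {p : V → ℕ} (G H : WithDegrees V p) : ℕ∞ :=
  (switchGraph V p).edist G H

/-- The switching distance from a multigraph to a set of multigraphs (`⊤` for the empty set). -/
noncomputable def dSwitchSet {V : Type*} [DecidableEq V] {p : V → ℕ} (G : WithDegrees V p)
    (S : Set (WithDegrees V p)) : ℕ∞ :=
  ⨅ H ∈ S, dSwitch G H

/-- The set `ℱ(V, p)` of disjoint unions of Frobenius pairs: `V` is partitioned into pairs of
distinct vertices, each pair is joined by `p` parallel edges, and there are no other edges. -/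
def frobenii (V : Type*) [DecidableEq V] (p : ℕ) : Set (WithDegrees V fun _ => p) :=
  {F | ∃ M : Finset (Sym2 V), (∀ e ∈ M, ¬ e.IsDiag) ∧ (∀ v, ∃! e, e ∈ M ∧ v ∈ e) ∧
    F.1 = ∑ e ∈ M, Multiset.replicate p e}

/-- The multiset `σ(∂v)` of colors of the edges at `v`; the color of a loop at `v` occurs twice.
The type `G` of edges has one element for each edge, counted with multiplicity. -/
def colorNbhd {V : Type*} [DecidableEq V] {G : MultiGraph V} {C : Type*} (σ : G → C) (v : V) :
    Multiset C :=
  ∑ e : G, inc (e : Sym2 V) v • ({σ e} : Multiset C)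

/-- A coloring is even if every multiset of colors is the colored neighborhood of an even number
of vertices. -/
def IsEvenColoring {V : Type*} [DecidableEq V] {G : MultiGraph V} {C : Type*} (σ : G → C) : Prop :=
  ∀ N : Multiset C, Even {v | colorNbhd σ v = N}.ncard

/-- The possible numbers of colors `|σ(E)|` used by an even coloring of the edges of `G`. -/
def evenColorCounts {V : Type*} [DecidableEq V] (G : MultiGraph V) : Set ℕ :=
  {k | ∃ (C : Type) (_ : Finite C) (σ : G → C), IsEvenColoring σ ∧ (Set.range σ).ncard = k}

/-- The largest number of colors in an even edge coloring. -/
noncomputable def cMax {V : Type*} [DecidableEq V] (G : MultiGraph V) : ℕ :=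
  sSup (evenColorCounts G)

/-- On an even number of vertices the supremum defining `cMax` is a maximum. -/
theorem isGreatest_cMax {V : Type*} [Fintype V] [DecidableEq V] (hV : Even (Fintype.card V))
    {p : ℕ} (G : WithDegrees V fun _ => p) : IsGreatest (evenColorCounts G.1) (cMax G.1) := by
  have hb : BddAbove (evenColorCounts G.1) := by
    refine ⟨Nat.card G.1, ?_⟩
    rintro k ⟨C, _, σ, -, rfl⟩
    rw [← Set.image_univ, ← Set.ncard_univ]
    exact Set.ncard_image_le
  have hne : (evenColorCounts G.1).Nonempty := by
    refine ⟨_, Unit, inferInstance, fun _ => (), ?_, rfl⟩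
    have key : ∀ v, colorNbhd (G := G.1) (fun _ => ()) v = Multiset.replicate p () := by
      intro v
      have h : (∑ e : G.1, inc (e : Sym2 V) v) = p := by
        have h1 : G.1.degree v = p := G.2 v
        rw [degree, ← Multiset.map_univ G.1 (fun e => inc e v)] at h1
        exact h1
      rw [colorNbhd, ← Finset.sum_smul, h, Multiset.nsmul_singleton]
    intro N
    by_cases hN : Multiset.replicate p () = N
    · have : {v : V | colorNbhd (G := G.1) (fun _ => ()) v = N} = Set.univ := by
        ext v; simp [key, hN]
      rw [this, Set.ncard_univ, Nat.card_eq_fintype_card]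
      exact hV
    · have : {v : V | colorNbhd (G := G.1) (fun _ => ()) v = N} = ∅ := by
        ext v; simp [key, hN]
      rw [this]; simp
  exact ⟨Nat.sSup_mem hne hb, fun k hk => le_csSup hb hk⟩

end MultiGraph

/-!
A coloring is even exactly when there is a pairing `f` of the vertices such that `v` and `f v` have
the same degree in every color class. The even colorings of `G` with `k` colors thus correspond to
the decompositions of `G` into `k` nonempty parts, all balanced with respect to a common pairing.

A switching lowers the maximal number of parts by at most one, since it suffices to merge the parts
of the two switched edges. Conversely, a balanced part with at least two edges can be split by
removing an edge `{v, f v}`, after creating one by a switching inside the part if necessary, so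
as long as `c_max < |E|` some switching raises `c_max`. Finally `c_max = |E|` means that every part
is a single edge `{v, f v}`, which characterizes the unions of Frobenius pairs. So `|E| - c_max` is
a potential that vanishes exactly on `𝓕`, changes by at most one along each switching and can be
decreased wherever it is positive, that is, the distance to `𝓕`.
-/

/-- A partition of a type into two-element sets, encoded as the fixed-point-free involution that
exchanges the elements of each pair. -/
structure IsPairing {V : Type*} (f : V → V) : Prop where
  involutive : Function.Involutive f
  ne_self (v : V) : f v ≠ v

theorem exists_isPairing_of_even_card {V : Type*} [Finite V] (h : Even (Nat.card V)) :
    ∃ f : V → V, IsPairing f := by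
  obtain ⟨k, hk⟩ := h
  have hcard : Nat.card V = Nat.card (Fin k × Bool) := by simp [hk, mul_two]
  obtain ⟨ε⟩ := Finite.card_eq.1 hcard
  refine ⟨fun v => ε.symm ((ε v).1, !(ε v).2), fun v => by simp, fun v hv => ?_⟩
  simpa using congrArg (fun x => (ε x).2) hv

theorem IsPairing.even_card {V : Type*} [Finite V] {f : V → V} (hf : IsPairing f) :
    Even (Nat.card V) := by
  have := Fintype.ofFinite V
  have hsum : ∑ _v : V, (1 : ZMod 2) = 0 :=
    Finset.sum_involution (fun v _ => f v) (fun _ _ => by decide) (fun v _ _ => hf.ne_self v)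
      (fun _ _ => Finset.mem_univ _) (fun v _ => hf.involutive v)
  rw [← ZMod.natCast_eq_zero_iff_even, Nat.card_eq_fintype_card]
  simpa using hsum

theorem even_ncard_fibers_iff_exists_isPairing {V X : Type*} [Finite V] {g : V → X} :
    (∀ x, Even {v | g v = x}.ncard) ↔ ∃ f : V → V, IsPairing f ∧ ∀ v, g (f v) = g v := by
  constructor
  · intro h
    choose f hf using fun x => exists_isPairing_of_even_card (V := {v // g v = x}) (h x)
    let ε := Equiv.sigmaFiberEquiv g
    have hmap : Function.Involutive (Sigma.map id f) := fun y =>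
      Sigma.ext rfl (heq_of_eq ((hf y.1).involutive y.2))
    refine ⟨fun v => ε (Sigma.map id f (ε.symm v)), ⟨fun v => ?_, fun v hv => ?_⟩,
      fun v => (f (g v) (ε.symm v).2).2⟩
    · simp only [Equiv.symm_apply_apply, hmap _, Equiv.apply_symm_apply]
    · exact (hf (g v)).ne_self (ε.symm v).2 (Subtype.ext hv)
  · rintro ⟨f, hf, hg⟩ x
    have hfib : IsPairing fun v : {v // g v = x} => (⟨f v, (hg v).trans v.2⟩ : {v // g v = x}) :=
      ⟨fun v => Subtype.ext (hf.involutive v), fun v hv => hf.ne_self v (congrArg Subtype.val hv)⟩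
    exact hfib.even_card

theorem IsPairing.mem_pair_iff {V : Type*} {f : V → V} (hf : IsPairing f) {a v : V} :
    v ∈ s(a, f a) ↔ s(v, f v) = s(a, f a) := by
  refine ⟨fun h => ?_, fun h => h ▸ Sym2.mem_mk_left v (f v)⟩
  rcases Sym2.mem_iff.1 h with rfl | rfl
  · rfl
  · rw [hf.involutive, Sym2.eq_swap]

section Potential

variable {α : Type*} {Γ : SimpleGraph α} {φ : α → ℕ}

theorem potential_le_add_edist (hlip : ∀ x y, Γ.Adj x y → φ x ≤ φ y + 1) (x y : α) :
    (φ x : ℕ∞) ≤ φ y + Γ.edist x y := by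
  have hwalk {x y : α} (w : Γ.Walk x y) : φ x ≤ φ y + w.length := by
    induction w with
    | nil => exact le_rfl
    | cons hadj w ih =>
      rw [SimpleGraph.Walk.length_cons]
      have := hlip _ _ hadj
      omega
  by_cases htop : Γ.edist x y = ⊤
  · simp [htop]
  · obtain ⟨w, hw⟩ := SimpleGraph.exists_walk_of_edist_ne_top htop
    rw [← hw]
    exact_mod_cast hwalk w

theorem exists_potential_eq_zero_and_edist_le
    (hdesc : ∀ x, φ x ≠ 0 → ∃ y, Γ.Adj x y ∧ φ y < φ x) (x : α) :
    ∃ y, φ y = 0 ∧ Γ.edist x y ≤ φ x := by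
  induction hn : φ x using Nat.strong_induction_on generalizing x with
  | _ n ih =>
    subst hn
    by_cases hx : φ x = 0
    · exact ⟨x, hx, by simp⟩
    · obtain ⟨y, hadj, hlt⟩ := hdesc x hx
      obtain ⟨z, hz, hle⟩ := ih (φ y) hlt y rfl
      refine ⟨z, hz, ?_⟩
      calc Γ.edist x z ≤ Γ.edist x y + Γ.edist y z := SimpleGraph.edist_triangle
        _ ≤ 1 + φ y := add_le_add (SimpleGraph.edist_eq_one_iff_adj.2 hadj).le hle
        _ ≤ φ x := by exact_mod_cast Nat.one_add_le_iff.2 hlt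

theorem iInf_edist_eq_potential (hlip : ∀ x y, Γ.Adj x y → φ x ≤ φ y + 1)
    (hdesc : ∀ x, φ x ≠ 0 → ∃ y, Γ.Adj x y ∧ φ y < φ x) (x : α) :
    ⨅ y ∈ {y | φ y = 0}, Γ.edist x y = φ x := by
  apply le_antisymm
  · obtain ⟨y, hy, hle⟩ := exists_potential_eq_zero_and_edist_le hdesc x
    exact (iInf₂_le y hy).trans hle
  · refine le_iInf₂ fun y hy => ?_
    have hy : φ y = 0 := hy
    simpa [hy] using potential_le_add_edist hlip x y

end Potential

namespace MultiGraph

section Degree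

variable {V : Type*} [DecidableEq V]

theorem inc_mk (a b v : V) :
    inc s(a, b) v = (if v = a then 1 else 0) + (if v = b then 1 else 0) := by
  change Multiset.count v (a ::ₘ b ::ₘ 0) = _
  simp only [Multiset.count_cons, Multiset.count_zero, zero_add, add_comm]

theorem inc_eq_zero_iff {e : Sym2 V} {v : V} : inc e v = 0 ↔ v ∉ e := by
  simp [inc, Multiset.count_eq_zero]

theorem inc_pair {f : V → V} (hf : IsPairing f) (a v : V) :
    inc s(a, f a) v = if s(v, f v) = s(a, f a) then 1 else 0 := by
  simp only [inc_mk, ← hf.mem_pair_iff, Sym2.mem_iff]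
  have := hf.ne_self a
  grind

theorem degree_add (A B : MultiGraph V) (v : V) :
    degree (A + B) v = degree A v + degree B v := by
  simp [degree]

theorem degree_cons (e : Sym2 V) (A : MultiGraph V) (v : V) :
    degree (e ::ₘ A) v = inc e v + degree A v := by
  simp [degree]

theorem exists_mem_of_degree_ne_zero {A : MultiGraph V} {v : V} (h : degree A v ≠ 0) :
    ∃ e ∈ A, v ∈ e := by
  by_contra! hc
  refine h (Multiset.sum_eq_zero fun x hx => ?_)
  obtain ⟨e, he, rfl⟩ := Multiset.mem_map.1 hx
  exact inc_eq_zero_iff.2 (hc e he)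

end Degree

section Switching

variable {V : Type*} {G H : MultiGraph V}

theorem Switching.symm (h : Switching G H) : Switching H G := by
  obtain ⟨v, w, v', w', R, rfl, rfl⟩ := h
  exact ⟨v, v', w, w', R, rfl, rfl⟩

theorem Switching.add_right (h : Switching G H) (L : MultiGraph V) :
    Switching (G + L) (H + L) := by
  obtain ⟨v, w, v', w', R, rfl, rfl⟩ := h
  exact ⟨v, w, v', w', R + L, by simp, by simp⟩

theorem Switching.card_eq (h : Switching G H) : Multiset.card G = Multiset.card H := by
  obtain ⟨v, w, v', w', R, rfl, rfl⟩ := h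
  simp

variable [DecidableEq V]

theorem Switching.degree_eq (h : Switching G H) (v : V) : degree G v = degree H v := by
  obtain ⟨a, b, c, d, R, rfl, rfl⟩ := h
  simp only [degree_cons, inc_mk]
  omega

theorem switchGraph_adj_iff {p : V → ℕ} {G H : WithDegrees V p} :
    (switchGraph V p).Adj G H ↔ G ≠ H ∧ Switching G.1 H.1 := by
  rw [switchGraph, SimpleGraph.fromRel_adj]
  exact and_congr_right fun _ => ⟨fun h => h.elim id Switching.symm, .inl⟩

end Switching

section Balanced

variable {V : Type*} [DecidableEq V] {f : V → V} {A B : MultiGraph V}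

/-- A multigraph is balanced with respect to a pairing `f` if paired vertices have the same degree.
An edge coloring is even precisely when all its color classes are balanced for a common pairing. -/
def Balanced (f : V → V) (A : MultiGraph V) : Prop :=
  ∀ v, degree A (f v) = degree A v

theorem Balanced.add (hA : Balanced f A) (hB : Balanced f B) : Balanced f (A + B) := fun v => by
  rw [degree_add, degree_add, hA v, hB v]

theorem Balanced.of_add_left (hA : Balanced f A) (hAB : Balanced f (A + B)) : Balanced f B :=
  fun v => by
    have := hAB v
    rwa [degree_add, degree_add, hA v, Nat.add_left_cancel_iff] at this

theorem Switching.balanced (h : Switching A B) (hA : Balanced f A) : Balanced f B := fun v => by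
  rw [← h.degree_eq, ← h.degree_eq, hA v]

theorem balanced_singleton_pair (hf : IsPairing f) (v : V) : Balanced f {s(v, f v)} := fun w => by
  simp only [degree, Multiset.map_singleton, Multiset.sum_singleton, inc_pair hf,
    hf.involutive w, Sym2.eq_swap (a := f w)]

/-- If `v` is joined to `x ≠ f v`, then, by balance, some edge `{f v, y}` exists too, and switching
the two creates the edge `{v, f v}`. -/
theorem Balanced.exists_pair_cons (hf : IsPairing f) (hA : Balanced f A) (hne : A ≠ 0) :
    ∃ v R, Balanced f R ∧ (A = s(v, f v) ::ₘ R ∨ Switching A (s(v, f v) ::ₘ R)) := by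
  obtain ⟨e, he⟩ := Multiset.exists_mem_of_ne_zero hne
  obtain ⟨R, rfl⟩ := Multiset.exists_cons_of_mem he
  induction e with | _ v x
  have hpair := balanced_singleton_pair hf v
  by_cases hx : x = f v
  · subst hx
    exact ⟨v, R, hpair.of_add_left hA, .inl rfl⟩
  · have hdeg : degree R (f v) ≠ 0 := by
      have := hA v
      simp only [degree_cons, inc_mk, hf.ne_self v, Ne.symm hx, if_true, if_false] at this
      omega
    obtain ⟨e, he, hmem⟩ := exists_mem_of_degree_ne_zero hdeg
    obtain ⟨y, rfl⟩ := Sym2.mem_iff_exists.1 hmem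
    obtain ⟨Q, rfl⟩ := Multiset.exists_cons_of_mem he
    have hs : Switching (s(v, x) ::ₘ s(f v, y) ::ₘ Q) (s(v, f v) ::ₘ s(x, y) ::ₘ Q) :=
      ⟨v, x, f v, y, Q, rfl, rfl⟩
    exact ⟨v, _, hpair.of_add_left (hs.balanced hA), .inr hs⟩

theorem Balanced.eq_pair_of_singleton (hf : IsPairing f) {e : Sym2 V} (h : Balanced f {e}) :
    ∃ v, e = s(v, f v) := by
  induction e with | _ v x
  refine ⟨v, ?_⟩
  by_contra hx
  replace hx : f v ≠ x := fun h => hx (h ▸ rfl)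
  have hdeg := h v
  simp only [degree, Multiset.map_singleton, Multiset.sum_singleton, inc_mk, hf.ne_self v, hx,
    if_true, if_false] at hdeg
  omega

end Balanced

section PairUnion

variable {V : Type*}

/-- Every edge of the multigraph joins two vertices exchanged by `f`. -/
def PairedBy (f : V → V) (G : MultiGraph V) : Prop :=
  ∀ e ∈ G, ∃ v, e = s(v, f v)

/-- The multigraphs with degree sequence `p` that are disjoint unions of pairs of vertices joined by
parallel edges. This extends `frobenii` to degree sequences that need not be constant. -/
def pairUnions (V : Type*) [DecidableEq V] (p : V → ℕ) : Set (WithDegrees V p) :=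
  {F | ∃ f : V → V, IsPairing f ∧ PairedBy f F.1}

theorem exists_isPairing_of_perfectMatching {M : Finset (Sym2 V)} (hdiag : ∀ e ∈ M, ¬ e.IsDiag)
    (huniq : ∀ v, ∃! e, e ∈ M ∧ v ∈ e) : ∃ f : V → V, IsPairing f ∧ PairedBy f M.val := by
  choose m hm hm_eq using huniq
  choose f hf using fun v => Sym2.mem_iff_exists.1 (hm v).2
  have hinv (v : V) : f (f v) = v := by
    have hmf : m v = m (f v) := hm_eq (f v) _ ⟨(hm v).1, hf v ▸ Sym2.mem_mk_right v (f v)⟩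
    rw [hf v, hf (f v), Sym2.eq_swap] at hmf
    exact (Sym2.congr_right.1 hmf).symm
  have hne (v : V) (h : f v = v) : False := by
    refine hdiag (m v) (hm v).1 ?_
    rw [hf v, h]
    exact Sym2.mk_isDiag_iff.2 rfl
  refine ⟨f, ⟨hinv, hne⟩, fun e he => ?_⟩
  induction e with | _ v w
  exact ⟨v, (hm_eq v _ ⟨he, Sym2.mem_mk_left v w⟩).trans (hf v)⟩

variable [DecidableEq V]

theorem PairedBy.count_pair {f : V → V} {G : MultiGraph V} (hG : PairedBy f G) (hf : IsPairing f)
    (v : V) : G.count s(v, f v) = degree G v := by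
  induction G using Multiset.induction with
  | empty => rfl
  | cons e G ih =>
    obtain ⟨x, rfl⟩ := hG e (Multiset.mem_cons_self _ _)
    rw [Multiset.count_cons, degree_cons, ih fun e he => hG e (Multiset.mem_cons_of_mem he),
      inc_pair hf, add_comm]

theorem PairedBy.eq_sum_replicate [Fintype V] {f : V → V} {p : ℕ} {F : MultiGraph V}
    (hF : PairedBy f F) (hf : IsPairing f) (hdeg : ∀ v, degree F v = p) :
    F = ∑ e ∈ Finset.univ.image fun v => s(v, f v), Multiset.replicate p e := by
  ext e
  simp only [Multiset.count_sum', Multiset.count_replicate, Finset.sum_ite_eq']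
  split_ifs with he
  · obtain ⟨v, -, rfl⟩ := Finset.mem_image.1 he
    rw [hF.count_pair hf, hdeg]
  · refine Multiset.count_eq_zero.2 fun hmem => he ?_
    obtain ⟨v, rfl⟩ := hF e hmem
    exact Finset.mem_image_of_mem _ (Finset.mem_univ v)

theorem frobenii_eq_pairUnions [Finite V] (p : ℕ) : frobenii V p = pairUnions V fun _ => p := by
  have := Fintype.ofFinite V
  ext F
  constructor
  · rintro ⟨M, hdiag, huniq, hM⟩
    obtain ⟨f, hf, hfM⟩ := exists_isPairing_of_perfectMatching hdiag huniq
    refine ⟨f, hf, fun e he => ?_⟩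
    rw [hM, Multiset.mem_sum] at he
    obtain ⟨e', he', hmem⟩ := he
    exact Multiset.eq_of_mem_replicate hmem ▸ hfM e' he'
  · rintro ⟨f, hf, hF⟩
    refine ⟨Finset.univ.image fun v => s(v, f v), ?_, fun v => ?_, hF.eq_sum_replicate hf F.2⟩
    · simpa using fun v => (hf.ne_self v).symm
    · refine ⟨s(v, f v), ⟨Finset.mem_image_of_mem _ (Finset.mem_univ v), Sym2.mem_mk_left _ _⟩, ?_⟩
      rintro e ⟨he, hv⟩
      obtain ⟨x, -, rfl⟩ := Finset.mem_image.1 he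
      exact (hf.mem_pair_iff.1 hv).symm

end PairUnion

section EvenPartition

variable {V : Type*} [DecidableEq V] {f : V → V} {P : Multiset (MultiGraph V)}

/-- A decomposition of the multigraph `P.sum` into nonempty balanced parts: these are the color
classes of an even coloring with `card P` colors. -/
def IsEvenPartition (f : V → V) (P : Multiset (MultiGraph V)) : Prop :=
  ∀ A ∈ P, A ≠ 0 ∧ Balanced f A

theorem isEvenPartition_cons {A : MultiGraph V} :
    IsEvenPartition f (A ::ₘ P) ↔ (A ≠ 0 ∧ Balanced f A) ∧ IsEvenPartition f P :=
  Multiset.forall_mem_cons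

theorem IsEvenPartition.card_le (hP : IsEvenPartition f P) :
    Multiset.card P ≤ Multiset.card P.sum := by
  have h : Multiset.card (P.map Multiset.card) • 1 ≤ (P.map Multiset.card).sum := by
    refine Multiset.card_nsmul_le_sum fun n hn => ?_
    obtain ⟨A, hA, rfl⟩ := Multiset.mem_map.1 hn
    exact Multiset.card_pos.2 (hP A hA).1
  rwa [Multiset.card_map, nsmul_one, Nat.cast_id, ← Multiset.card_join] at h

theorem IsEvenPartition.exists_of_balanced {G : MultiGraph V} (hG : Balanced f G) :
    ∃ P, IsEvenPartition f P ∧ P.sum = G := by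
  obtain rfl | hne := eq_or_ne G 0
  · exact ⟨0, fun _ h => absurd h (Multiset.notMem_zero _), rfl⟩
  · exact ⟨{G}, by simpa [IsEvenPartition] using ⟨hne, hG⟩, Multiset.sum_singleton G⟩

theorem PairedBy.isEvenPartition {G : MultiGraph V} (hf : IsPairing f) (hG : PairedBy f G) :
    IsEvenPartition f (G.map ({·})) := by
  intro A hA
  obtain ⟨e, he, rfl⟩ := Multiset.mem_map.1 hA
  obtain ⟨v, rfl⟩ := hG e he
  exact ⟨Multiset.singleton_ne_zero _, balanced_singleton_pair hf v⟩

theorem IsEvenPartition.pairedBy (hf : IsPairing f) (hP : IsEvenPartition f P)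
    (hcard : Multiset.card P = Multiset.card P.sum) : PairedBy f P.sum := by
  intro e he
  obtain ⟨A, hA, heA⟩ := Multiset.mem_join.1 he
  obtain ⟨Q, rfl⟩ := Multiset.exists_cons_of_mem hA
  obtain ⟨⟨-, hbal⟩, hQ⟩ := isEvenPartition_cons.1 hP
  have hA1 : Multiset.card A ≤ 1 := by
    have := hQ.card_le
    simp only [Multiset.card_cons, Multiset.sum_cons, Multiset.card_add] at hcard
    omega
  obtain ⟨R, rfl⟩ := Multiset.exists_cons_of_mem heA
  obtain rfl : R = 0 := by simpa using hA1
  exact hbal.eq_pair_of_singleton hf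

theorem IsEvenPartition.exists_refinement (hf : IsPairing f) (hP : IsEvenPartition f P)
    (hcard : Multiset.card P < Multiset.card P.sum) :
    ∃ P', IsEvenPartition f P' ∧ Multiset.card P' = Multiset.card P + 1 ∧
      (P.sum = P'.sum ∨ Switching P.sum P'.sum) := by
  obtain ⟨A, hA, hlt⟩ : ∃ A ∈ P, 1 < Multiset.card A := by
    by_contra! hle
    refine hcard.not_ge ((Multiset.card_join P).trans_le ?_)
    simpa using Multiset.sum_le_card_nsmul (P.map Multiset.card) 1 (by simpa using hle)
  obtain ⟨Q, rfl⟩ := Multiset.exists_cons_of_mem hA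
  obtain ⟨⟨hne, hbal⟩, hQ⟩ := isEvenPartition_cons.1 hP
  obtain ⟨v, R, hR, hAR⟩ := hbal.exists_pair_cons hf hne
  have hcardR : Multiset.card A = Multiset.card R + 1 := by
    rw [← Multiset.card_cons s(v, f v) R]
    exact hAR.elim (congrArg _) Switching.card_eq
  have hR0 : R ≠ 0 := by
    rintro rfl
    simp [hcardR] at hlt
  have hsum : (({s(v, f v)} : MultiGraph V) ::ₘ R ::ₘ Q).sum = (s(v, f v) ::ₘ R) + Q.sum := by
    simp
  refine ⟨{s(v, f v)} ::ₘ R ::ₘ Q, ?_, by simp, ?_⟩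
  · exact isEvenPartition_cons.2 ⟨⟨Multiset.singleton_ne_zero _, balanced_singleton_pair hf v⟩,
      isEvenPartition_cons.2 ⟨⟨hR0, hR⟩, hQ⟩⟩
  · rw [hsum, Multiset.sum_cons]
    exact hAR.imp (congrArg (· + Q.sum)) (·.add_right Q.sum)

theorem IsEvenPartition.exists_merge (hP : IsEvenPartition f P) {e e' : Sym2 V} {R : MultiGraph V}
    (hsum : P.sum = e ::ₘ e' ::ₘ R) :
    ∃ A Q, IsEvenPartition f ((e ::ₘ e' ::ₘ A) ::ₘ Q) ∧ A + Q.sum = R ∧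
      Multiset.card P ≤ Multiset.card Q + 2 := by
  obtain ⟨A, hA, heA⟩ := Multiset.mem_join.1 (hsum ▸ Multiset.mem_cons_self e _ : e ∈ P.sum)
  obtain ⟨Q, rfl⟩ := Multiset.exists_cons_of_mem hA
  obtain ⟨A, rfl⟩ := Multiset.exists_cons_of_mem heA
  have hrest : A + Q.sum = e' ::ₘ R := by simpa using hsum
  obtain he' | he' := Multiset.mem_add.1 (hrest ▸ Multiset.mem_cons_self e' R : e' ∈ A + Q.sum)
  · obtain ⟨A, rfl⟩ := Multiset.exists_cons_of_mem he'
    exact ⟨A, Q, hP, by simpa using hrest, by simp⟩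
  · obtain ⟨B, hB, heB⟩ := Multiset.mem_join.1 he'
    obtain ⟨Q, rfl⟩ := Multiset.exists_cons_of_mem hB
    obtain ⟨B, rfl⟩ := Multiset.exists_cons_of_mem heB
    obtain ⟨⟨-, hbalA⟩, hQ⟩ := isEvenPartition_cons.1 hP
    obtain ⟨⟨-, hbalB⟩, hQ⟩ := isEvenPartition_cons.1 hQ
    refine ⟨A + B, Q, isEvenPartition_cons.2 ⟨⟨Multiset.cons_ne_zero, ?_⟩, hQ⟩, ?_, by simp⟩
    · simpa [Multiset.cons_swap e] using hbalA.add hbalB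
    · simpa [add_assoc] using hrest

theorem Switching.exists_isEvenPartition {G H : MultiGraph V} (h : Switching G H)
    (hP : IsEvenPartition f P) (hsum : P.sum = G) :
    ∃ P', IsEvenPartition f P' ∧ P'.sum = H ∧ Multiset.card P ≤ Multiset.card P' + 1 := by
  obtain ⟨v, w, v', w', R, rfl, rfl⟩ := h
  obtain ⟨A, Q, hAQ, rfl, hcard⟩ := hP.exists_merge hsum
  obtain ⟨⟨-, hbal⟩, hQ⟩ := isEvenPartition_cons.1 hAQ
  have hs : Switching (s(v, w) ::ₘ s(v', w') ::ₘ A) (s(v, v') ::ₘ s(w, w') ::ₘ A) :=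
    ⟨v, w, v', w', A, rfl, rfl⟩
  exact ⟨(s(v, v') ::ₘ s(w, w') ::ₘ A) ::ₘ Q,
    isEvenPartition_cons.2 ⟨⟨Multiset.cons_ne_zero, hs.balanced hbal⟩, hQ⟩,
    by simp, by simpa using hcard⟩

end EvenPartition

section ColorClass

variable {V C : Type*} [DecidableEq V] [DecidableEq C] {G : MultiGraph V}

/-- The submultigraph formed by the edges of color `c`. -/
def colorClass (σ : G → C) (c : C) : MultiGraph V :=
  ({e | σ e = c} : Finset G).val.map fun e : G => (e : Sym2 V)

theorem colorClass_ne_zero_iff (σ : G → C) (c : C) : colorClass σ c ≠ 0 ↔ c ∈ Set.range σ := by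
  simp [colorClass]

theorem sum_colorClass [Fintype C] (σ : G → C) : ∑ c, colorClass σ c = G := by
  calc ∑ c, colorClass σ c = ∑ c, ∑ e with σ e = c, {(e : Sym2 V)} := by
        refine Finset.sum_congr rfl fun c _ => ?_
        rw [colorClass, ← Multiset.sum_map_singleton (Multiset.map _ _), Multiset.map_map]
        rfl
    _ = ∑ e : G, {(e : Sym2 V)} := Finset.sum_fiberwise _ _ _
    _ = G := by
        rw [Finset.sum, Multiset.map_univ G fun e => ({e} : MultiGraph V),
          Multiset.sum_map_singleton]

theorem exists_colorClass_eq_map_filter (K : Multiset (Sym2 V × C)) :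
    ∃ σ : K.map Prod.fst → C, ∀ c, colorClass σ c = (K.filter (·.2 = c)).map Prod.fst := by
  let ε := K.mapEquiv Prod.fst
  refine ⟨fun e => (ε.symm e : Sym2 V × C).2, fun c => ?_⟩
  rw [colorClass, Finset.filter_val, ← Multiset.map_univ_val_equiv ε, Multiset.filter_map,
    Multiset.map_map]
  conv_rhs => rw [← Multiset.map_univ_coe K, Multiset.filter_map, Multiset.map_map]
  simp [ε, Multiset.mapEquiv_apply]

theorem exists_colorClass_eq [Fintype C] (A : C → MultiGraph V) :
    ∃ σ : (∑ c, A c : MultiGraph V) → C, colorClass σ = A := by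
  let K : Multiset (Sym2 V × C) := ∑ c, (A c).map (·, c)
  have hK : K.map Prod.fst = ∑ c, A c :=
    (map_sum (Multiset.mapAddMonoidHom Prod.fst) _ _).trans (by simp [Multiset.map_map])
  rw [← hK]
  obtain ⟨σ, hσ⟩ := exists_colorClass_eq_map_filter K
  refine ⟨σ, funext fun c => (hσ c).trans ?_⟩
  let restrict : Multiset (Sym2 V × C) →+ MultiGraph V :=
    { toFun L := (L.filter (·.2 = c)).map Prod.fst
      map_zero' := rfl
      map_add' L L' := by rw [Multiset.filter_add, Multiset.map_add] }
  have hrestrict (d : C) : restrict ((A d).map (·, d)) = if d = c then A d else 0 := by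
    change (((A d).map (·, d)).filter (·.2 = c)).map Prod.fst = _
    by_cases hd : d = c <;> simp [Multiset.filter_map, Multiset.map_map, hd]
  calc restrict K = ∑ d, if d = c then A d else 0 := by
        rw [map_sum]; exact Finset.sum_congr rfl fun d _ => hrestrict d
    _ = A c := by simp

theorem count_colorNbhd (σ : G → C) (v : V) (c : C) :
    (colorNbhd σ v).count c = degree (colorClass σ c) v := by
  calc (colorNbhd σ v).count c = ∑ e : G, if σ e = c then inc (e : Sym2 V) v else 0 := by
        simp [colorNbhd, Multiset.count_sum', Multiset.count_singleton, eq_comm]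
    _ = ∑ e : G with σ e = c, inc (e : Sym2 V) v := (Finset.sum_filter _ _).symm
    _ = degree (colorClass σ c) v := by rw [degree, colorClass, Multiset.map_map]; rfl

theorem isEvenColoring_iff [Finite V] {σ : G → C} :
    IsEvenColoring σ ↔ ∃ f : V → V, IsPairing f ∧ ∀ c, Balanced f (colorClass σ c) := by
  rw [IsEvenColoring, even_ncard_fibers_iff_exists_isPairing]
  simp only [Multiset.ext, count_colorNbhd]
  exact exists_congr fun f => and_congr_right fun _ => forall_comm

end ColorClass

section EvenColoring

variable {V : Type*} [DecidableEq V] [Finite V] {G : MultiGraph V}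

theorem IsEvenColoring.exists_isEvenPartition {C : Type*} [Finite C] {σ : G → C}
    (hσ : IsEvenColoring σ) : ∃ f : V → V, IsPairing f ∧
      ∃ P, IsEvenPartition f P ∧ P.sum = G ∧ Multiset.card P = (Set.range σ).ncard := by
  classical
  have := Fintype.ofFinite C
  obtain ⟨f, hf, hbal⟩ := isEvenColoring_iff.1 hσ
  refine ⟨f, hf, ({c | colorClass σ c ≠ 0} : Finset C).val.map (colorClass σ), ?_, ?_, ?_⟩
  · intro A hA
    obtain ⟨c, hc, rfl⟩ := Multiset.mem_map.1 hA
    exact ⟨(Finset.mem_filter.1 hc).2, hbal c⟩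
  · exact (Finset.sum_filter_ne_zero _).trans (sum_colorClass σ)
  · rw [Multiset.card_map, Finset.card_val, ← Set.ncard_coe_finset]
    congr 1
    ext c
    simp [colorClass_ne_zero_iff]

theorem IsEvenPartition.card_mem_evenColorCounts {f : V → V}
    {P : Multiset (MultiGraph V)} (hP : IsEvenPartition f P) (hf : IsPairing f) :
    Multiset.card P ∈ evenColorCounts P.sum := by
  induction P using Quotient.inductionOn with | _ l
  change ∀ A ∈ l, A ≠ 0 ∧ Balanced f A at hP
  obtain ⟨σ, hσ⟩ := exists_colorClass_eq l.get
  have hsum : ∑ i, l.get i = (l : Multiset (MultiGraph V)).sum := by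
    rw [Multiset.sum_coe, ← List.sum_ofFn, List.ofFn_get]
  have hrange : Set.range σ = Set.univ := Set.eq_univ_of_forall fun i => by
    rw [← colorClass_ne_zero_iff, hσ]
    exact (hP _ (l.get_mem i)).1
  change l.length ∈ evenColorCounts (l : Multiset (MultiGraph V)).sum
  rw [← hsum]
  refine ⟨Fin l.length, inferInstance, σ, isEvenColoring_iff.2 ⟨f, hf, fun i => ?_⟩, ?_⟩
  · rw [hσ]
    exact (hP _ (l.get_mem i)).2
  · rw [hrange, Set.ncard_univ, Nat.card_eq_fintype_card, Fintype.card_fin]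

theorem mem_evenColorCounts_iff {k : ℕ} :
    k ∈ evenColorCounts G ↔ ∃ f : V → V, IsPairing f ∧
      ∃ P, IsEvenPartition f P ∧ P.sum = G ∧ Multiset.card P = k := by
  constructor
  · rintro ⟨C, _, σ, hσ, rfl⟩
    exact hσ.exists_isEvenPartition
  · rintro ⟨f, hf, P, hP, rfl, rfl⟩
    exact hP.card_mem_evenColorCounts hf

end EvenColoring

section CMax

variable {V : Type*} [DecidableEq V] [Finite V]

theorem card_mem_upperBounds_evenColorCounts (G : MultiGraph V) :
    Multiset.card G ∈ upperBounds (evenColorCounts G) := by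
  intro k hk
  obtain ⟨f, -, P, hP, rfl, rfl⟩ := mem_evenColorCounts_iff.1 hk
  exact hP.card_le

theorem cMax_le_card (G : MultiGraph V) : cMax G ≤ Multiset.card G :=
  csSup_le' (card_mem_upperBounds_evenColorCounts G)

theorem IsEvenPartition.card_le_cMax {f : V → V} {P : Multiset (MultiGraph V)}
    (hP : IsEvenPartition f P) (hf : IsPairing f) : Multiset.card P ≤ cMax P.sum :=
  le_csSup ⟨_, card_mem_upperBounds_evenColorCounts _⟩ (hP.card_mem_evenColorCounts hf)

variable {p : V → ℕ} (hp : ∀ n, Even {v | p v = n}.ncard) {G H : WithDegrees V p}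

include hp

theorem exists_isEvenPartition_card_eq_cMax (G : WithDegrees V p) :
    ∃ f : V → V, IsPairing f ∧
      ∃ P, IsEvenPartition f P ∧ P.sum = G.1 ∧ Multiset.card P = cMax G.1 := by
  obtain ⟨f, hf, hpf⟩ := even_ncard_fibers_iff_exists_isPairing.1 hp
  have hbal : Balanced f G.1 := fun v => by rw [G.2, G.2, hpf]
  obtain ⟨P, hP, hsum⟩ := IsEvenPartition.exists_of_balanced hbal
  exact mem_evenColorCounts_iff.1 <| Nat.sSup_mem
    ⟨_, mem_evenColorCounts_iff.2 ⟨f, hf, P, hP, hsum, rfl⟩⟩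
    ⟨_, card_mem_upperBounds_evenColorCounts _⟩

theorem cMax_eq_card_iff : cMax G.1 = Multiset.card G.1 ↔ G ∈ pairUnions V p := by
  constructor
  · intro h
    obtain ⟨f, hf, P, hP, hsum, hcard⟩ := exists_isEvenPartition_card_eq_cMax hp G
    exact ⟨f, hf, hsum ▸ hP.pairedBy hf (by rw [hcard, h, hsum])⟩
  · rintro ⟨f, hf, hG⟩
    refine (cMax_le_card G.1).antisymm ?_
    simpa using (hG.isEvenPartition hf).card_le_cMax hf

theorem Switching.cMax_le (h : Switching G.1 H.1) : cMax G.1 ≤ cMax H.1 + 1 := by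
  obtain ⟨f, hf, P, hP, hsum, hcard⟩ := exists_isEvenPartition_card_eq_cMax hp G
  obtain ⟨P', hP', hsum', hle⟩ := h.exists_isEvenPartition hP hsum
  rw [← hcard, ← hsum']
  exact hle.trans (Nat.add_le_add_right (hP'.card_le_cMax hf) 1)

theorem exists_adj_cMax_lt (h : cMax G.1 < Multiset.card G.1) :
    ∃ H, (switchGraph V p).Adj G H ∧ cMax G.1 < cMax H.1 := by
  obtain ⟨f, hf, P, hP, hsum, hcard⟩ := exists_isEvenPartition_card_eq_cMax hp G
  obtain ⟨P', hP', hcard', hG⟩ := hP.exists_refinement hf (by rwa [hcard, hsum])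
  have hlt : cMax G.1 < cMax P'.sum := by
    have := hP'.card_le_cMax hf
    omega
  rw [hsum] at hG
  have hs : Switching G.1 P'.sum := hG.resolve_left fun heq => hlt.ne (by rw [heq])
  exact ⟨⟨P'.sum, fun v => hs.degree_eq v ▸ G.2 v⟩,
    switchGraph_adj_iff.2 ⟨fun heq => hlt.ne (congrArg (fun H => cMax H.1) heq), hs⟩, hlt⟩

end CMax

end MultiGraph

open MultiGraph in
theorem mainTheorem9_general {V : Type*} [Finite V] [DecidableEq V] {p : V → ℕ}
    (hp : ∀ n, Even {v | p v = n}.ncard) (G : WithDegrees V p) :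
    (cMax G.1 : ℕ∞) + dSwitchSet G (pairUnions V p) = (Multiset.card G.1 : ℕ∞) := by
  let φ (H : WithDegrees V p) : ℕ := Multiset.card H.1 - cMax H.1
  have hzero : pairUnions V p = {H | φ H = 0} := by
    ext H
    exact (cMax_eq_card_iff hp).symm.trans
      ((cMax_le_card H.1).ge_iff_eq.symm.trans tsub_eq_zero_iff_le.symm)
  have hdist : dSwitchSet G (pairUnions V p) = φ G := by
    rw [hzero]
    refine iInf_edist_eq_potential (fun H K hadj => ?_) (fun H hH => ?_) G
    · have hs := (switchGraph_adj_iff.1 hadj).2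
      have := hs.card_eq
      have := hs.symm.cMax_le hp
      grind
    · obtain ⟨K, hadj, hlt⟩ := exists_adj_cMax_lt hp (Nat.sub_ne_zero_iff_lt.1 hH)
      have := (switchGraph_adj_iff.1 hadj).2.card_eq
      exact ⟨K, hadj, by grind⟩
  rw [hdist]
  exact_mod_cast Nat.add_sub_of_le (cMax_le_card G.1)

theorem mainTheorem9 {V : Type*} [Fintype V] [DecidableEq V] (hV : Even (Fintype.card V))
    (p : ℕ) (G : MultiGraph.WithDegrees V fun _ => p) :
    (MultiGraph.cMax G.1 : ℕ∞) + MultiGraph.dSwitchSet G (MultiGraph.frobenii V p)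
      = (Multiset.card G.1 : ℕ∞) := by
  rw [MultiGraph.frobenii_eq_pairUnions]
  exact mainTheorem9_general (fun n => by by_cases hn : p = n <;> simp [hn, hV]) G
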